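/- Let $k\ge 1$, $n_1,\dots,n_k\ge 1$, let $\mathcal K$ be a complex Hilbert space and $\mathcal H$ an infinite dimensional separable complex Hilbert space. For each $i$ let $q_i=\sum_{\alpha} a_{i,\alpha}Z_{\alpha}\in\mathbb C\langle Z_1,\dots,Z_{n_i}\rangle$ be a positive regular noncommutative polynomial (all coefficients are nonnegative, the constant term is zero, the coefficients of $Z_1,\dots,Z_{n_i}$ are nonzero). Let $\mathbb F_{n_i}^+$ be the free monoid on $n_i$ generators, with word length $|\cdot|$, and for $\alpha\in\mathbb F_{n_i}^+$ put $b_{i,\alpha}=1$ if $\alpha$ is the empty word and otherwise $$b_{i,\alpha}=\sum_{p=1}^{|\alpha|}\ \sum_{\gamma_1\cdots\gamma_p=\alpha,\ |\gamma_j|\ge 1} a_{i,\gamma_1}\cdots a_{i,\gamma_p}.$$ For $\mathbf p\in\mathbb Z_{\ge 0}^k$ let $\Lambda_{\mathbf p}$ be the set of all $\boldsymbol\alpha=(\alpha_1,\dots,\alpha_k)\in\mathbb F_{n_1}^+\times\cdots\times\mathbb F_{n_k}^+$ with $|\alpha_i|=p_i$ for all $i$. Let $B(\mathcal H)^{n_1}\times_c\cdots\times_c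 B(\mathcal H)^{n_k}$ be the set of tuples $\mathbf X=(X_1,\dots,X_k)$, $X_i=(X_{i,1},\dots,X_{i,n_i})\in B(\mathcal H)^{n_i}$, such that the entries of $X_s$ commute with the entries of $X_t$ whenever $s\ne t$. Put $X_{i,\alpha}=X_{i,j_1}\cdots X_{i,j_p}$ for the word $\alpha=g_{j_1}\cdots g_{j_p}$, and $\mathbf X_{\boldsymbol\alpha}=X_{1,\alpha_1}\cdots X_{k,\alpha_k}$. Let $\Phi_{q_i,X_i}(Y)=\sum_\alpha a_{i,\alpha}X_{i,\alpha}YX_{i,\alpha}^*$ for $Y\in B(\mathcal H)$, and let $\mathbf D_{\mathbf q}(\mathcal H)$ be the set of all $\mathbf X\in B(\mathcal H)^{n_1}\times_c\cdots\times_c B(\mathcal H)^{n_k}$ for which $(\mathrm{id}-\Phi_{q_1,X_1})\circ\cdots\circ(\mathrm{id}-\Phi_{q_k,X_k})(I)$ is positive and invertible. Let $F:B(\mathcal H)^{n_1}\times_c\cdots\times_c B(\mathcal H)^{n_k}\to B(\mathcal K)\otimes_{min}B(\mathcal H)$ be an entire function, represented by the formal power series with coefficients $A_{(\boldsymbol\alpha)}\in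 B(\mathcal K)$; that is, for every $\rho>0$ and every $\mathbf X\in\rho\,\mathbf D_{\mathbf q}(\mathcal H)$, $$F(\mathbf X)=\sum_{\mathbf p\in\mathbb Z_{\ge 0}^k}\ \sum_{\boldsymbol\alpha\in\Lambda_{\mathbf p}}A_{(\boldsymbol\alpha)}\otimes\mathbf X_{\boldsymbol\alpha},$$ where the series over $\mathbf p$ converges (unconditionally) in the operator norm. 1. If there are $C>0$ and $\mathbf m=(m_1,\dots,m_k)\in\mathbb Z_{\ge 0}^k$ such that $$\|F(\mathbf X)\|\le C\,\Bigl\|\sum_{\boldsymbol\alpha\in\Lambda_{\mathbf m}}b_{1,\alpha_1}\cdots b_{k,\alpha_k}\,\mathbf X_{\boldsymbol\alpha}\mathbf X_{\boldsymbol\alpha}^*\Bigr\|^{1/2}\qquad\text{for all }\mathbf X\in B(\mathcal H)^{n_1}\times_c\cdots\times_c B(\mathcal H)^{n_k},$$ then $F$ is a polynomial of degree at most $m_1+\cdots+m_k$: $A_{(\boldsymbol\alpha)}=0$ whenever $|\alpha_1|+\cdots+|\alpha_k|>m_1+\cdots+m_k$, and $F(\mathbf X)$ is the finite sum of the remaining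 terms $A_{(\boldsymbol\alpha)}\otimes\mathbf X_{\boldsymbol\alpha}$ for all $\mathbf X$. 2. In particular, if $F$ is bounded on $B(\mathcal H)^{n_1}\times_c\cdots\times_c B(\mathcal H)^{n_k}$, then $F$ is constant: $A_{(\boldsymbol\alpha)}=0$ for every $\boldsymbol\alpha$ other than the tuple of empty words, and $F(\mathbf X)=A_{(\emptyset,\dots,\emptyset)}\otimes I$ for all $\mathbf X$. -/

import Mathlib

open scoped TensorProduct

noncomputable section

namespace RegularPolydomain

/-! ### Words and polynomials in noncommuting indeterminates

The unital free semigroup on `n` generators is `FreeMonoid (Fin n)`; its unit is the empty word. -/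

/-- Noncommutative polynomials `ℂ⟨Z₁, …, Zₙ⟩`; the coefficient of `Z_α` in `q` is `q.coeff α`. -/
abbrev NCPoly (n : ℕ) : Type := MonoidAlgebra ℂ (FreeMonoid (Fin n))

open scoped ComplexOrder in
/-- Positive regular polynomials: the coefficients are nonnegative real numbers, the constant
term is zero and the coefficients of `Z₁, …, Zₙ` are different from zero. -/
structure IsPositiveRegular {n : ℕ} (q : NCPoly n) : Prop where
  nonneg : ∀ α, 0 ≤ q.coeff α
  const_eq_zero : q.coeff 1 = 0
  linear_ne_zero : ∀ j : Fin n, q.coeff (FreeMonoid.of j) ≠ 0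

/-- The weights `b_α` associated with `q = ∑ a_α Z_α`: the sum of `a_{γ₁} ⋯ a_{γ_p}` over all ways
of writing `α = γ₁ ⋯ γ_p` with nonempty words `γ₁, …, γ_p`. Such factorizations correspond to the
compositions of the integer `|α|`. For the empty word there is only the empty factorization, so
that `b = 1`. -/
def weight {n : ℕ} (q : NCPoly n) (α : FreeMonoid (Fin n)) : ℂ :=
  ∑ c : Composition α.toList.length,
    ((α.toList.splitWrtComposition c).map fun γ => q.coeff (FreeMonoid.ofList γ)).prod

/-- Multi-words `(α₁, …, α_k)`, where `α_i` is a word in `n i` generators. -/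
abbrev MultiWord {k : ℕ} (n : Fin k → ℕ) : Type := ∀ i, FreeMonoid (Fin (n i))

open Classical in
/-- The finite set `Λ_p` of the multi-words with `|α_i| = p i` for all `i`. -/
def Lam {k : ℕ} (n : Fin k → ℕ) (p : Fin k → ℕ) : Finset (MultiWord n) :=
  Fintype.piFinset fun i =>
    (Finset.univ : Finset (Fin (p i) → Fin (n i))).image fun f => FreeMonoid.ofList (List.ofFn f)

theorem mem_Lam {k : ℕ} {n : Fin k → ℕ} {p : Fin k → ℕ} {α : MultiWord n} :
    α ∈ Lam n p ↔ ∀ i, (α i).length = p i := by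
  simp only [Lam, Fintype.mem_piFinset, Finset.mem_image, Finset.mem_univ, true_and]
  refine forall_congr' fun i => ⟨?_, fun h => ?_⟩
  · rintro ⟨f, hf⟩
    rw [← hf]
    exact List.length_ofFn
  · have h' : (α i).toList.length = p i := h
    refine ⟨fun j => (α i).toList.get (j.cast h'.symm), ?_⟩
    apply FreeMonoid.toList.injective
    rw [FreeMonoid.toList_ofList]
    exact List.ext_getElem (by simp [h']) (by simp)

/-- `b_{1,α₁} ⋯ b_{k,α_k}`. -/
def multiWeight {k : ℕ} {n : Fin k → ℕ} (q : ∀ i, NCPoly (n i)) (α : MultiWord n) : ℂ :=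
  ∏ i, weight (q i) (α i)

/-! ### Tuples of operators and regular polydomains -/

section Tuples

variable {k : ℕ} {n : Fin k → ℕ} (H : Type*) [NormedAddCommGroup H] [InnerProductSpace ℂ H]

/-- `B(H)^{n_1} × ⋯ × B(H)^{n_k}`. -/
abbrev Tuple (n : Fin k → ℕ) : Type _ := ∀ i, Fin (n i) → (H →L[ℂ] H)

/-- `B(H)^{n_1} ×_c ⋯ ×_c B(H)^{n_k}`: the entries of `X s` commute with the entries of `X t`
for `s ≠ t`; no commutation is required inside one `X s`. -/
def CommTuple (n : Fin k → ℕ) : Set (Tuple H n) :=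
  {X | ∀ s t, s ≠ t → ∀ j l, Commute (X s j) (X t l)}

variable {H}

/-- `X_α = X_{1,α₁} ⋯ X_{k,α_k}`, where `X_{i,α_i} = X_{i,j₁} ⋯ X_{i,j_p}` for the word
`α_i = g_{j₁} ⋯ g_{j_p}`. -/
def wordEval (X : Tuple H n) (α : MultiWord n) : H →L[ℂ] H :=
  (List.ofFn fun i => FreeMonoid.lift (X i) (α i)).prod

variable [CompleteSpace H]

/-- `Φ_{q,A}(Y) = ∑ a_α A_α Y A_α^*` for a tuple `A` and a polynomial `q = ∑ a_α Z_α`. -/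
def Phi {d : ℕ} (q : NCPoly d) (A : Fin d → (H →L[ℂ] H)) : Module.End ℂ (H →L[ℂ] H) :=
  ∑ α ∈ q.coeff.support,
    q.coeff α • LinearMap.mulLeftRight ℂ (FreeMonoid.lift A α, star (FreeMonoid.lift A α))

theorem Phi_apply {d : ℕ} (q : NCPoly d) (A : Fin d → (H →L[ℂ] H)) (Y : H →L[ℂ] H) :
    Phi q A Y = ∑ α ∈ q.coeff.support,
      q.coeff α • (FreeMonoid.lift A α * Y * star (FreeMonoid.lift A α)) := by
  simp [Phi, LinearMap.sum_apply]

/-- The defect mapping `(id - Φ_{q_1,X_1}) ∘ ⋯ ∘ (id - Φ_{q_k,X_k})`; multiplication in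
`Module.End` is composition. -/
def defect (q : ∀ i, NCPoly (n i)) (X : Tuple H n) : Module.End ℂ (H →L[ℂ] H) :=
  (List.ofFn fun i => 1 - Phi (q i) (X i)).prod

variable (H)

/-- The regular polydomain `D_q(H)`: the tuples in `B(H)^{n_1} ×_c ⋯ ×_c B(H)^{n_k}` for which the
defect operator is positive and invertible. -/
def polydomain (q : ∀ i, NCPoly (n i)) : Set (Tuple H n) :=
  {X | X ∈ CommTuple H n ∧ (defect q X 1).IsPositive ∧ IsUnit (defect q X 1)}

/-- The dilated polydomain `ρ D_q(H) = {ρ X : X ∈ D_q(H)}`. -/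
def scaledPolydomain (q : ∀ i, NCPoly (n i)) (ρ : ℝ) : Set (Tuple H n) :=
  {X | ∃ Y ∈ polydomain H q, ∀ i j, X i j = (ρ : ℂ) • Y i j}

end Tuples

/-! ### Hilbert space tensor products and the spatial tensor product of operator spaces -/

section Tensor

variable (K : Type*) [NormedAddCommGroup K] [InnerProductSpace ℂ K]
  (H : Type*) [NormedAddCommGroup H] [InnerProductSpace ℂ H]

/-- The Hilbert space tensor product of `K` and `H`: the completion of the algebraic tensor product
for the inner product `⟪x ⊗ y, x' ⊗ y'⟫ = ⟪x, x'⟫ ⟪y, y'⟫`. -/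
abbrev HilbertTensor : Type _ := UniformSpace.Completion (K ⊗[ℂ] H)

variable {K H}

/-- The bounded operator `A ⊗ X` on the Hilbert space tensor product. -/
def opTensor (A : K →L[ℂ] K) (X : H →L[ℂ] H) : HilbertTensor K H →L[ℂ] HilbertTensor K H :=
  ((UniformSpace.Completion.toComplL (𝕜 := ℂ) (E := K ⊗[ℂ] H)).comp
    (TensorProduct.mapL A X)).extend UniformSpace.Completion.toComplL

theorem opTensor_tmul (A : K →L[ℂ] K) (X : H →L[ℂ] H) (x : K) (y : H) :
    opTensor A X ((x ⊗ₜ[ℂ] y : K ⊗[ℂ] H) : HilbertTensor K H) =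
      ((A x ⊗ₜ[ℂ] X y : K ⊗[ℂ] H) : HilbertTensor K H) :=
  ContinuousLinearMap.extend_eq _ UniformSpace.Completion.denseRange_coe
    (UniformSpace.Completion.isUniformInducing_coe _) (x ⊗ₜ[ℂ] y)

variable (K H)

/-- The minimal (spatial) tensor product `B(K) ⊗_min B(H)`: the norm closure, in the bounded
operators on the Hilbert space tensor product, of the span of the operators `A ⊗ X`. -/
def MinTensor : Submodule ℂ (HilbertTensor K H →L[ℂ] HilbertTensor K H) :=
  (Submodule.span ℂ {T | ∃ (A : K →L[ℂ] K) (X : H →L[ℂ] H), T = opTensor A X}).topologicalClosure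

end Tensor

/-! ### Formal power series and entire functions -/

section Series

variable {k : ℕ} {n : Fin k → ℕ} {K : Type*} [NormedAddCommGroup K] [InnerProductSpace ℂ K]
  {H : Type*} [NormedAddCommGroup H] [InnerProductSpace ℂ H]

/-- A formal power series `∑_α A_(α) ⊗ Z_α` with coefficients in `B(K)`, given by its
coefficients. -/
abbrev FormalSeries {k : ℕ} (n : Fin k → ℕ) (K : Type*) [NormedAddCommGroup K]
    [InnerProductSpace ℂ K] : Type _ := MultiWord n → (K →L[ℂ] K)

/-- The multi-homogeneous part `∑_{α ∈ Λ_p} A_(α) ⊗ X_α`. -/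
def homogPart (φ : FormalSeries n K) (X : Tuple H n) (p : Fin k → ℕ) :
    HilbertTensor K H →L[ℂ] HilbertTensor K H :=
  ∑ α ∈ Lam n p, opTensor (φ α) (wordEval X α)

variable [CompleteSpace H]

/-- `F` is given on `ρ D_q(H)` by the formal power series `φ`, whose series of multi-homogeneous
parts converges in the operator norm at every point of `ρ D_q(H)`. -/
def IsFreeHolomorphicOn (q : ∀ i, NCPoly (n i)) (ρ : ℝ) (φ : FormalSeries n K)
    (F : CommTuple H n → MinTensor K H) : Prop :=
  ∀ X : CommTuple H n, X.1 ∈ scaledPolydomain H q ρ → HasSum (homogPart φ X.1) (F X).1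

/-- `F`, with the power series representation `φ`, is an entire function on
`B(H)^{n_1} ×_c ⋯ ×_c B(H)^{n_k}`: it is free holomorphic on `ρ D_q(H)` for every `ρ > 0`. -/
def IsEntire (q : ∀ i, NCPoly (n i)) (φ : FormalSeries n K)
    (F : CommTuple H n → MinTensor K H) : Prop :=
  ∀ ρ : ℝ, 0 < ρ → IsFreeHolomorphicOn q ρ φ F

/-- `F`, with the power series representation `φ`, is a polynomial of degree at most `d`: all
coefficients of total degree greater than `d` vanish, and `F` is the sum of the finitely many
multi-homogeneous parts of total degree at most `d`. -/
def IsPolynomialOfDegreeLE (d : ℕ) (φ : FormalSeries n K)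
    (F : CommTuple H n → MinTensor K H) : Prop :=
  (∀ α : MultiWord n, d < ∑ i, (α i).length → φ α = 0) ∧
    ∀ X : CommTuple H n,
      (F X).1 = ∑ e ∈ Finset.range (d + 1),
        ∑ p ∈ Finset.piAntidiag (Finset.univ : Finset (Fin k)) e, homogPart φ X.1 p

/-- `F`, with the power series representation `φ`, is constant: all coefficients but the one of the
empty multi-word vanish, and `F X = A_(1) ⊗ I` for all `X`. -/
def IsConstant (φ : FormalSeries n K) (F : CommTuple H n → MinTensor K H) : Prop :=
  (∀ α : MultiWord n, α ≠ 1 → φ α = 0) ∧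
    ∀ X : CommTuple H n, (F X).1 = opTensor (φ 1) 1

end Series

end RegularPolydomain

end

open RegularPolydomain

open RegularPolydomain Filter Topology

/-! ### Cauchy estimates for entire functions of one variable -/

/-! The theorem is Liouville's theorem on complex lines. Every commuting tuple `X` lies in some
dilated polydomain (`exists_mem_scaledPolydomain`), so `z ↦ F (z • X)` is an operator-valued entire
function whose Taylor coefficients are the parts of `F` of total degree `d` at `X`. The hypothesis
bounds it by a constant times `‖z‖ ^ N`, and Cauchy's estimates kill all parts of degree `d > N`.
Coefficients are recovered by evaluating at the left creation operators of the monoid of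
multi-words, which act on `H` because `H` is separable and infinite dimensional: there distinct
words send the vacuum vector `b 1` to orthogonal vectors. Boundedness is the case `N = 0`. -/

theorem hasFPowerSeriesOnBall_mkPiRing {E : Type*} [NormedAddCommGroup E] [NormedSpace ℂ E]
    {a : ℕ → E} {f : ℂ → E} (hf : ∀ z, HasSum (fun d => z ^ d • a d) (f z)) :
    HasFPowerSeriesOnBall f
      (fun d => ContinuousMultilinearMap.mkPiRing ℂ (Fin d) (a d)) 0 ⊤ := by
  refine ⟨?_, by simp, fun {y} _ => by simpa using hf y⟩
  refine ENNReal.le_of_forall_nnreal_lt fun r _ => ?_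
  refine FormalMultilinearSeries.le_radius_of_tendsto _ (l := 0) ?_
  -- Convergence at the point `r` forces `‖a d‖ * r ^ d → 0`, so the radius is at least `r`.
  have h := (hf (r : ℂ)).summable.tendsto_atTop_zero.norm
  simpa [norm_smul, mul_comm] using h

theorem coeff_eq_zero_of_norm_le_pow {E : Type*} [NormedAddCommGroup E] [NormedSpace ℂ E]
    [CompleteSpace E] {a : ℕ → E} {f : ℂ → E} (hf : ∀ z, HasSum (fun d => z ^ d • a d) (f z))
    {C : ℝ} {N : ℕ} (hC : ∀ z, ‖f z‖ ≤ C * ‖z‖ ^ N) {d : ℕ} (hd : N < d) : a d = 0 := by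
  have hp := hasFPowerSeriesOnBall_mkPiRing hf
  have hdiff : Differentiable ℂ f := fun z =>
    (hp.differentiableOn z (by simp)).differentiableAt (by simp)
  have hder : iteratedDeriv d f 0 = (d.factorial : ℂ) • a d := by
    rw [iteratedDeriv_eq_iteratedFDeriv, ← hp.factorial_smul 1 d, Nat.cast_smul_eq_nsmul]
    simp
  -- Cauchy's estimate on the circle of radius `R`, to be used with `R → ∞`.
  have hbound : ∀ R : ℝ, 0 < R → ‖a d‖ ≤ C * R⁻¹ ^ (d - N) := by
    intro R hR
    have h := Complex.norm_iteratedDeriv_le_of_forall_mem_sphere_norm_le (c := 0) d hR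
      (hdiff.diffContOnCl) (C := C * R ^ N) (fun z hz => by
        have : ‖z‖ = R := by simpa using hz
        simpa [this] using hC z)
    rw [hder, norm_smul, Complex.norm_natCast, mul_div_assoc] at h
    have hfac : (0 : ℝ) < d.factorial := by exact_mod_cast d.factorial_pos
    have h' := le_of_mul_le_mul_left h hfac
    rwa [mul_div_assoc, show R ^ N / R ^ d = R⁻¹ ^ (d - N) by
      rw [inv_pow, div_eq_iff (by positivity), inv_mul_eq_div, eq_div_iff (by positivity),
        ← pow_add, Nat.add_sub_cancel' hd.le]] at h'
  have hlim : Tendsto (fun R : ℝ => C * R⁻¹ ^ (d - N)) atTop (𝓝 0) := by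
    simpa [(Nat.sub_pos_of_lt hd).ne'] using
      ((tendsto_inv_atTop_zero (𝕜 := ℝ)).pow (d - N)).const_mul C
  exact norm_le_zero_iff.1 (ge_of_tendsto hlim ((eventually_gt_atTop 0).mono hbound))

/-! ### Words evaluated at scaled tuples -/

section Scaling

variable {k : ℕ} {n : Fin k → ℕ} {H : Type*} [NormedAddCommGroup H] [InnerProductSpace ℂ H]

theorem lift_smul {A : Type*} [Semiring A] [Algebra ℂ A] {ι : Type*} (z : ℂ) (x : ι → A)
    (w : FreeMonoid ι) :
    FreeMonoid.lift (z • x) w = z ^ w.length • FreeMonoid.lift x w := by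
  induction w using FreeMonoid.inductionOn' with
  | one => simp
  | of_mul j w ih =>
    simp [ih, FreeMonoid.length_mul, pow_add, smul_smul, mul_comm]

theorem prod_ofFn_smul {A : Type*} [Semiring A] [Algebra ℂ A] {k : ℕ} (c : Fin k → ℂ)
    (T : Fin k → A) :
    (List.ofFn fun i => c i • T i).prod = (∏ i, c i) • (List.ofFn T).prod := by
  induction k with
  | zero => simp
  | succ k ih => simp [List.ofFn_succ, ih, Fin.prod_univ_succ, smul_smul, mul_comm]

theorem wordEval_smul (z : ℂ) (X : Tuple H n) (α : MultiWord n) :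
    wordEval (z • X) α = z ^ (∑ i, (α i).length) • wordEval X α := by
  simp only [wordEval, Pi.smul_apply, lift_smul]
  rw [prod_ofFn_smul, Finset.prod_pow_eq_pow_sum]

theorem sum_length_of_mem_Lam {p : Fin k → ℕ} {α : MultiWord n} (h : α ∈ Lam n p) :
    ∑ i, (α i).length = ∑ i, p i :=
  Finset.sum_congr rfl fun i _ => mem_Lam.1 h i

theorem smul_mem_CommTuple (z : ℂ) {X : Tuple H n} (hX : X ∈ CommTuple H n) :
    z • X ∈ CommTuple H n := fun s t hst j l =>
  ((hX s t hst j l).smul_left z).smul_right z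

variable {K : Type*} [NormedAddCommGroup K] [InnerProductSpace ℂ K]

theorem opTensor_smul_right (A : K →L[ℂ] K) (z : ℂ) (X : H →L[ℂ] H) :
    opTensor A (z • X) = z • opTensor A X := by
  refine ContinuousLinearMap.ext fun v => ?_
  induction v using UniformSpace.Completion.induction_on with
  | hp => exact isClosed_eq (opTensor A (z • X)).continuous (z • opTensor A X).continuous
  | ih v =>
    induction v using TensorProduct.induction_on with
    | zero => rw [UniformSpace.Completion.coe_zero, map_zero, map_zero]
    | tmul x y =>
      rw [smul_apply, opTensor_tmul, opTensor_tmul,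
        smul_apply, TensorProduct.tmul_smul, UniformSpace.Completion.coe_smul]
    | add v w hv hw => rw [UniformSpace.Completion.coe_add, map_add, map_add, hv, hw]

theorem homogPart_smul (φ : FormalSeries n K) (z : ℂ) (X : Tuple H n) (p : Fin k → ℕ) :
    homogPart φ (z • X) p = z ^ (∑ i, p i) • homogPart φ X p := by
  rw [homogPart, homogPart, Finset.smul_sum]
  refine Finset.sum_congr rfl fun α hα => ?_
  rw [wordEval_smul, opTensor_smul_right, sum_length_of_mem_Lam hα]

end Scaling

/-! ### Every commuting tuple lies in a dilated polydomain -/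

section Absorbing

variable {k : ℕ} {n : Fin k → ℕ} {H : Type*} [NormedAddCommGroup H] [InnerProductSpace ℂ H]
  [CompleteSpace H]

theorem Phi_smul_apply {d : ℕ} (q : NCPoly d) (t : ℝ) (A : Fin d → (H →L[ℂ] H))
    (Y : H →L[ℂ] H) :
    Phi q ((t : ℂ) • A) Y = ∑ α ∈ q.coeff.support, ((t : ℂ) ^ (2 * α.length)) •
      q.coeff α • (FreeMonoid.lift A α * Y * star (FreeMonoid.lift A α)) := by
  rw [Phi_apply]
  refine Finset.sum_congr rfl fun α _ => ?_
  simp only [lift_smul, star_smul, smul_mul_assoc, mul_smul_comm, smul_smul]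
  congr 1
  simp
  ring

theorem continuous_Phi_smul {d : ℕ} (q : NCPoly d) (A : Fin d → (H →L[ℂ] H))
    {Y : ℝ → (H →L[ℂ] H)} (hY : Continuous Y) :
    Continuous fun t : ℝ => Phi q ((t : ℂ) • A) (Y t) := by
  simp only [Phi_smul_apply]
  fun_prop

/-- Only the empty word survives at the zero tuple, and its coefficient is zero. -/
theorem Phi_zero {d : ℕ} {q : NCPoly d} (hq : IsPositiveRegular q) :
    Phi q (0 : Fin d → (H →L[ℂ] H)) = 0 := by
  refine LinearMap.ext fun Y => ?_
  rw [Phi_apply, LinearMap.zero_apply]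
  refine Finset.sum_eq_zero fun α hα => ?_
  have h1 : α ≠ 1 := by
    rintro rfl
    exact Finsupp.mem_support_iff.1 hα hq.const_eq_zero
  have h0 : FreeMonoid.lift (0 : Fin d → (H →L[ℂ] H)) α = 0 := by
    have h := lift_smul 0 (0 : Fin d → (H →L[ℂ] H)) α
    rwa [smul_zero, zero_pow (by simpa [FreeMonoid.length_eq_zero] using h1), zero_smul] at h
  simp [h0]

open scoped ComplexOrder in
theorem isSelfAdjoint_Phi {d : ℕ} {q : NCPoly d} (hq : IsPositiveRegular q)
    (A : Fin d → (H →L[ℂ] H)) {Y : H →L[ℂ] H} (hY : IsSelfAdjoint Y) :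
    IsSelfAdjoint (Phi q A Y) := by
  rw [Phi_apply]
  refine isSelfAdjoint_sum _ fun α _ => IsSelfAdjoint.smul ?_ (hY.conjugate _)
  exact IsSelfAdjoint.of_nonneg (hq.nonneg α)

theorem isSelfAdjoint_defect {q : ∀ i, NCPoly (n i)} (hq : ∀ i, IsPositiveRegular (q i))
    (X : Tuple H n) : IsSelfAdjoint (defect q X 1) := by
  have key : ∀ L : List (Module.End ℂ (H →L[ℂ] H)),
      (∀ T ∈ L, ∀ Y, IsSelfAdjoint Y → IsSelfAdjoint (T Y)) → IsSelfAdjoint (L.prod 1) := by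
    intro L
    induction L with
    | nil => intro _; exact IsSelfAdjoint.one _
    | cons T L ih =>
      intro h
      rw [List.prod_cons, Module.End.mul_apply]
      exact h T (by simp) _ (ih fun S hS => h S (by simp [hS]))
  refine key _ fun T hT Y hY => ?_
  obtain ⟨i, rfl⟩ := (List.mem_ofFn' _ _).1 hT
  exact hY.sub (isSelfAdjoint_Phi (hq i) _ hY)

theorem continuous_defect_smul (q : ∀ i, NCPoly (n i)) (X : Tuple H n) :
    Continuous fun t : ℝ => defect q ((t : ℂ) • X) 1 := by
  -- Each factor acts on an operator that already depends on `t`, so the induction carries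
  -- continuous curves rather than fixed operators.
  have key : ∀ L : List (ℝ → Module.End ℂ (H →L[ℂ] H)),
      (∀ T ∈ L, ∀ Y : ℝ → (H →L[ℂ] H), Continuous Y → Continuous fun t => T t (Y t)) →
        Continuous fun t => (L.map fun T => T t).prod 1 := by
    intro L
    induction L with
    | nil => intro _; exact continuous_const
    | cons T L ih =>
      intro h
      simp only [List.map_cons, List.prod_cons, Module.End.mul_apply]
      exact h T (by simp) _ (ih fun S hS => h S (by simp [hS]))
  have h := key (List.ofFn fun i (t : ℝ) => 1 - Phi (q i) ((t : ℂ) • X i)) fun T hT Y hY => by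
    obtain ⟨i, rfl⟩ := (List.mem_ofFn' _ _).1 hT
    exact hY.sub (continuous_Phi_smul (q i) (X i) hY)
  simp only [List.map_ofFn] at h
  exact h

theorem defect_zero {q : ∀ i, NCPoly (n i)} (hq : ∀ i, IsPositiveRegular (q i)) :
    defect q (0 : Tuple H n) = 1 := by
  rw [defect]
  refine List.prod_eq_one fun T hT => ?_
  obtain ⟨i, rfl⟩ := (List.mem_ofFn' _ _).1 hT
  simp [Phi_zero (hq i)]

theorem isPositive_of_norm_one_sub_le {T : H →L[ℂ] H} (hT : IsSelfAdjoint T)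
    (h : ‖1 - T‖ ≤ 1) : T.IsPositive := by
  refine ⟨ContinuousLinearMap.isSelfAdjoint_iff_isSymmetric.1 hT, fun x => ?_⟩
  have h1 : RCLike.re (inner ℂ ((1 - T) x) x) ≤ ‖x‖ * ‖x‖ :=
    (re_inner_le_norm _ _).trans <| mul_le_mul_of_nonneg_right
      (((1 - T).le_of_opNorm_le h x).trans_eq (one_mul _)) (norm_nonneg x)
  rw [sub_apply, one_apply_eq_self, inner_sub_left, map_sub,
    inner_self_eq_norm_mul_norm] at h1
  simpa [ContinuousLinearMap.reApplyInnerSelf_apply] using h1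

/-- The defect operator of `t • X` tends to `1` as `t → 0`. At distance less than `1` from the
identity it is invertible by the Neumann series, and positive since it is self-adjoint; then `ρ =
t⁻¹` works. -/
theorem exists_mem_scaledPolydomain {q : ∀ i, NCPoly (n i)} (hq : ∀ i, IsPositiveRegular (q i))
    {X : Tuple H n} (hX : X ∈ CommTuple H n) : ∃ ρ : ℝ, 0 < ρ ∧ X ∈ scaledPolydomain H q ρ := by
  have hlim : Tendsto (fun t : ℝ => ‖1 - defect q ((t : ℂ) • X) 1‖) (𝓝[>] 0) (𝓝 0) := by
    have hc : Continuous fun t : ℝ => ‖1 - defect q ((t : ℂ) • X) 1‖ :=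
      (continuous_const.sub (continuous_defect_smul q X)).norm
    have h := hc.tendsto 0
    rw [Complex.ofReal_zero, zero_smul, defect_zero hq, Module.End.one_apply, sub_self,
      norm_zero] at h
    exact h.mono_left nhdsWithin_le_nhds
  obtain ⟨t, ht, ht0⟩ := ((hlim.eventually_lt_const one_pos).and self_mem_nhdsWithin).exists
  have ht0 : (0 : ℝ) < t := ht0
  refine ⟨t⁻¹, inv_pos.2 ht0, (t : ℂ) • X, ⟨smul_mem_CommTuple _ hX,
    isPositive_of_norm_one_sub_le (isSelfAdjoint_defect hq _) ht.le, ?_⟩, fun i j => ?_⟩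
  · simpa using (Units.oneSub _ ht).isUnit
  · have : (t : ℂ) ≠ 0 := by exact_mod_cast ht0.ne'
    rw [Pi.smul_apply, Pi.smul_apply, smul_smul, Complex.ofReal_inv, inv_mul_cancel₀ this, one_smul]

end Absorbing

/-! ### Left creation operators -/

section Creation

variable {M : Type*} [Monoid M] [IsLeftCancelMul M] {H : Type*} [NormedAddCommGroup H]
  [InnerProductSpace ℂ H] [CompleteSpace H]

/-- The isometry that maps the basis vector of `x` to the one of `a * x`. -/
noncomputable def creationOp (b : HilbertBasis M ℂ H) (a : M) : H →L[ℂ] H :=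
  ((b.orthonormal.comp _ (mul_right_injective a)).orthogonalFamily.linearIsometry.comp
    b.repr.toLinearIsometry).toContinuousLinearMap

theorem creationOp_apply (b : HilbertBasis M ℂ H) (a x : M) :
    creationOp b a (b x) = b (a * x) := by
  classical
  have h := (b.orthonormal.comp _
    (mul_right_injective a)).orthogonalFamily.linearIsometry_apply_single (i := x) (1 : ℂ)
  rw [← b.repr_self] at h
  exact h.trans (one_smul ℂ _)

/-- The left regular representation of a left cancellative monoid. -/
noncomputable def creation (b : HilbertBasis M ℂ H) : M →* (H →L[ℂ] H) where
  toFun := creationOp b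
  map_one' := by
    refine ContinuousLinearMap.ext_on (s := Set.range b)
      (Submodule.dense_iff_topologicalClosure_eq_top.2 b.dense_span) ?_
    rintro _ ⟨x, rfl⟩
    simp [creationOp_apply]
  map_mul' a c := by
    refine ContinuousLinearMap.ext_on (s := Set.range b)
      (Submodule.dense_iff_topologicalClosure_eq_top.2 b.dense_span) ?_
    rintro _ ⟨x, rfl⟩
    simp [creationOp_apply, mul_assoc]

theorem creation_apply (b : HilbertBasis M ℂ H) (a x : M) :
    creation b a (b x) = b (a * x) := creationOp_apply b a x

theorem prod_ofFn_eq_of_forall_ne {N : Type*} [Monoid N] {k : ℕ} (f : Fin k → N) (j : Fin k)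
    (h : ∀ i, i ≠ j → f i = 1) : (List.ofFn f).prod = f j := by
  induction k with
  | zero => exact j.elim0
  | succ k ih =>
    rw [List.ofFn_succ, List.prod_cons]
    induction j using Fin.cases with
    | zero =>
      rw [List.prod_eq_one, mul_one]
      intro x hx
      obtain ⟨i, rfl⟩ := (List.mem_ofFn' _ _).1 hx
      exact h _ (Fin.succ_ne_zero i)
    | succ j =>
      rw [h 0 (Fin.succ_ne_zero j).symm, one_mul]
      exact ih (fun i => f i.succ) j fun i hi => h _ ((Fin.succ_injective k).ne hi)

theorem prod_ofFn_mulSingle {k : ℕ} {N : Fin k → Type*} [∀ i, Monoid (N i)] (α : ∀ i, N i) :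
    (List.ofFn fun i => Pi.mulSingle i (α i)).prod = α := by
  funext j
  have h := map_list_prod (Pi.evalMonoidHom N j) (List.ofFn fun i => Pi.mulSingle i (α i))
  rw [Pi.evalMonoidHom_apply, List.map_ofFn] at h
  rw [h, prod_ofFn_eq_of_forall_ne _ j fun i hi => by simp [Pi.mulSingle_eq_of_ne' hi]]
  simp

variable {k : ℕ} {n : Fin k → ℕ}

/-- The tuple of the left creation operators of the generators. -/
noncomputable def creationTuple (b : HilbertBasis (MultiWord n) ℂ H) : Tuple H n :=
  fun i j => creation b (Pi.mulSingle i (FreeMonoid.of j))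

theorem creationTuple_mem (b : HilbertBasis (MultiWord n) ℂ H) :
    creationTuple b ∈ CommTuple H n := fun _ _ hst _ _ =>
  (Pi.mulSingle_commute hst _ _).map (creation b)

/-- In each coordinate two monoid homomorphisms agree on the generators, and `α` is the product of
its coordinates. -/
theorem wordEval_creationTuple (b : HilbertBasis (MultiWord n) ℂ H) (α : MultiWord n) :
    wordEval (creationTuple b) α = creation b α := by
  have h : ∀ i, FreeMonoid.lift (creationTuple b i) =
      (creation b).comp (MonoidHom.mulSingle (fun i => FreeMonoid (Fin (n i))) i) := fun i =>
    FreeMonoid.hom_eq fun j => by simp [creationTuple]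
  conv_rhs => rw [← prod_ofFn_mulSingle α, map_list_prod, List.map_ofFn]
  simp [wordEval, h, Function.comp_def]

theorem infinite_multiWord (hk : 1 ≤ k) (hn : ∀ i, 1 ≤ n i) : Infinite (MultiWord n) := by
  have : Nonempty (Fin k) := ⟨⟨0, hk⟩⟩
  have : ∀ i, Nonempty (Fin (n i)) := fun i => ⟨⟨0, hn i⟩⟩
  have : ∀ i, Infinite (FreeMonoid (Fin (n i))) := fun i =>
    inferInstanceAs (Infinite (List (Fin (n i))))
  infer_instance

theorem countable_multiWord : Countable (MultiWord n) := by
  have : ∀ i, Countable (FreeMonoid (Fin (n i))) := fun i =>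
    inferInstanceAs (Countable (List (Fin (n i))))
  infer_instance

theorem nonempty_hilbertBasis (ι : Type*) [Countable ι] [Infinite ι]
    [TopologicalSpace.SeparableSpace H] (hH : ¬ FiniteDimensional ℂ H) :
    Nonempty (HilbertBasis ι ℂ H) := by
  obtain ⟨w, b, -⟩ := exists_hilbertBasis ℂ H
  -- Basis vectors are at mutual distance `√2`, so the balls of radius `1 / 2` around them are
  -- disjoint; separability allows only countably many.
  have hc : Countable w := by
    refine Pairwise.countable_of_isOpen_disjoint (s := fun i => Metric.ball (b i) (1 / 2))
      (fun i j hij => Metric.ball_disjoint_ball ?_) (fun _ => Metric.isOpen_ball)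
      fun i => Metric.nonempty_ball.2 (by norm_num)
    have h : ‖b i - b j‖ ^ 2 = 2 := by
      rw [@norm_sub_sq ℂ, b.orthonormal.1, b.orthonormal.1, b.orthonormal.2 hij]
      norm_num
    rw [dist_eq_norm]
    nlinarith [norm_nonneg (b i - b j)]
  have hi : Infinite w := by
    by_contra hfin
    have : Finite w := not_infinite_iff_finite.1 hfin
    have := Fintype.ofFinite w
    exact hH (b.toOrthonormalBasis.toBasis.finiteDimensional_of_finite)
  obtain ⟨e⟩ : Nonempty (ι ≃ w) := inferInstance
  refine ⟨HilbertBasis.mk (b.orthonormal.comp e e.injective) ?_⟩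
  rw [EquivLike.range_comp]
  exact b.dense_span.ge

variable {K : Type*} [NormedAddCommGroup K] [InnerProductSpace ℂ K]

/-- The operators `A ⊗ X_α` are independent at the creation tuple. -/
theorem eq_zero_of_sum_opTensor_creationTuple_eq_zero (b : HilbertBasis (MultiWord n) ℂ H)
    (φ : FormalSeries n K) (s : Finset (MultiWord n))
    (h : ∑ α ∈ s, opTensor (φ α) (wordEval (creationTuple b) α) = 0) {α : MultiWord n}
    (hα : α ∈ s) : φ α = 0 := by
  classical
  ext x
  refine ext_inner_left ℂ fun y => ?_
  -- The `β` term sends `x ⊗ b 1` to `φ β x ⊗ b β`; pairing with `y ⊗ b α` isolates `β = α`.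
  have h1 := congrArg (fun T : HilbertTensor K H →L[ℂ] HilbertTensor K H =>
    inner ℂ ((y ⊗ₜ[ℂ] b α : K ⊗[ℂ] H) : HilbertTensor K H)
      (T ((x ⊗ₜ[ℂ] b 1 : K ⊗[ℂ] H) : HilbertTensor K H))) h
  simpa [sum_apply, opTensor_tmul, wordEval_creationTuple, creation_apply,
    inner_sum, UniformSpace.Completion.inner_coe, orthonormal_iff_ite.1 b.orthonormal, hα] using h1

end Creation

/-! ### Entire functions of polynomial growth -/

section Main

variable {k : ℕ} {n : Fin k → ℕ} {K : Type*} [NormedAddCommGroup K] [InnerProductSpace ℂ K]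
  {H : Type*} [NormedAddCommGroup H] [InnerProductSpace ℂ H]

/-- The homogeneous part of total degree `d`. -/
noncomputable def totalHomogPart (φ : FormalSeries n K) (X : Tuple H n) (d : ℕ) :
    HilbertTensor K H →L[ℂ] HilbertTensor K H :=
  ∑ p ∈ Finset.piAntidiag (Finset.univ : Finset (Fin k)) d, homogPart φ X p

theorem totalHomogPart_smul (φ : FormalSeries n K) (z : ℂ) (X : Tuple H n) (d : ℕ) :
    totalHomogPart φ (z • X) d = z ^ d • totalHomogPart φ X d := by
  rw [totalHomogPart, totalHomogPart, Finset.smul_sum]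
  refine Finset.sum_congr rfl fun p hp => ?_
  rw [homogPart_smul, (Finset.mem_piAntidiag.1 hp).1]

/-- Unconditional convergence permits regrouping by total degree, and each group is finite. -/
theorem hasSum_totalHomogPart {φ : FormalSeries n K} {X : Tuple H n}
    {T : HilbertTensor K H →L[ℂ] HilbertTensor K H} (h : HasSum (homogPart φ X) T) :
    HasSum (totalHomogPart φ X) T := by
  have h1 := (Equiv.sigmaFiberEquiv fun p : Fin k → ℕ => ∑ i, p i).hasSum_iff.2 h
  refine h1.sigma fun d => ?_
  have hset : {p : Fin k → ℕ | ∑ i, p i = d} =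
      ↑(Finset.piAntidiag (Finset.univ : Finset (Fin k)) d) := by
    ext p; simp
  have h2 : HasSum (fun p : {p : Fin k → ℕ | ∑ i, p i = d} => homogPart φ X p)
      (totalHomogPart φ X d) := by
    rw [hset]
    exact Finset.hasSum _ _
  exact h2

theorem isConstant_of_isPolynomialOfDegreeLE_zero {φ : FormalSeries n K}
    {F : CommTuple H n → MinTensor K H} (h : IsPolynomialOfDegreeLE 0 φ F) :
    IsConstant φ F := by
  refine ⟨fun α hα => h.1 α ?_, fun X => ?_⟩
  · obtain ⟨i, hi⟩ := Function.ne_iff.1 hα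
    refine Finset.sum_pos' (fun _ _ => Nat.zero_le _) ⟨i, Finset.mem_univ i, ?_⟩
    exact Nat.pos_of_ne_zero fun h0 => hi (FreeMonoid.length_eq_zero.1 h0)
  · have hLam : Lam n (0 : Fin k → ℕ) = {1} := by
      ext α
      simp [mem_Lam, funext_iff]
    rw [h.2 X]
    simp [homogPart, hLam, wordEval]

variable [CompleteSpace H]

theorem hasSum_of_isEntire {q : ∀ i, NCPoly (n i)} (hq : ∀ i, IsPositiveRegular (q i))
    {φ : FormalSeries n K} {F : CommTuple H n → MinTensor K H} (hF : IsEntire q φ F)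
    (X : CommTuple H n) : HasSum (totalHomogPart φ X.1) (F X).1 := by
  obtain ⟨ρ, hρ, hX⟩ := exists_mem_scaledPolydomain hq X.2
  exact hasSum_totalHomogPart (hF ρ hρ X hX)

/-- The constant may depend on `X`, since Cauchy's estimates are applied on one complex line at a
time. -/
theorem isPolynomialOfDegreeLE_of_growth (hk : 1 ≤ k) (hn : ∀ i, 1 ≤ n i)
    [TopologicalSpace.SeparableSpace H] (hH : ¬ FiniteDimensional ℂ H)
    {φ : FormalSeries n K} {F : CommTuple H n → MinTensor K H}
    (hF : ∀ X : CommTuple H n, HasSum (totalHomogPart φ X.1) (F X).1) {N : ℕ}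
    (hgrowth : ∀ X : CommTuple H n, ∃ C : ℝ, ∀ z : ℂ,
      ‖F ⟨z • X.1, smul_mem_CommTuple z X.2⟩‖ ≤ C * ‖z‖ ^ N) :
    IsPolynomialOfDegreeLE N φ F := by
  have hzero : ∀ (X : CommTuple H n) (d : ℕ), N < d → totalHomogPart φ X.1 d = 0 := by
    intro X d hd
    obtain ⟨C, hC⟩ := hgrowth X
    refine coeff_eq_zero_of_norm_le_pow
      (f := fun z => (F ⟨z • X.1, smul_mem_CommTuple z X.2⟩).1) (fun z => ?_) hC hd
    simp only [← totalHomogPart_smul]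
    exact hF ⟨z • X.1, smul_mem_CommTuple z X.2⟩
  refine ⟨fun α hα => ?_, fun X => ?_⟩
  · have := infinite_multiWord hk hn
    have := countable_multiWord (n := n)
    obtain ⟨b⟩ := nonempty_hilbertBasis (MultiWord n) hH
    have h := hzero ⟨_, creationTuple_mem b⟩ _ hα
    simp only [totalHomogPart, homogPart] at h
    classical
    -- Word lengths determine `p`, so the sets `Lam n p` are disjoint and the double sum is one sum
    -- over distinct multi-words.
    rw [← Finset.sum_biUnion] at h
    · refine eq_zero_of_sum_opTensor_creationTuple_eq_zero b φ _ h
        (Finset.mem_biUnion.2 ⟨fun i => (α i).length, ?_, mem_Lam.2 fun i => rfl⟩)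
      simp
    · intro p _ p' _ hp
      refine Finset.disjoint_left.2 fun β hβ hβ' => hp ?_
      funext i
      rw [← mem_Lam.1 hβ i, mem_Lam.1 hβ' i]
  · refine (hF X).unique (hasSum_sum_of_ne_finset_zero fun d hd => hzero X d ?_)
    simpa using hd

end Main

theorem mainTheorem8 {k : ℕ} (hk : 1 ≤ k) (n : Fin k → ℕ) (hn : ∀ i, 1 ≤ n i)
    (q : ∀ i, NCPoly (n i)) (hq : ∀ i, IsPositiveRegular (q i))
    {K : Type*} [NormedAddCommGroup K] [InnerProductSpace ℂ K] [CompleteSpace K]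
    {H : Type*} [NormedAddCommGroup H] [InnerProductSpace ℂ H] [CompleteSpace H]
    [TopologicalSpace.SeparableSpace H] (hH : ¬ FiniteDimensional ℂ H)
    (φ : FormalSeries n K) (F : CommTuple H n → MinTensor K H) (hF : IsEntire q φ F) :
    (∀ (m : Fin k → ℕ) (C : ℝ), 0 < C →
      (∀ X : CommTuple H n, ‖F X‖ ≤ C * Real.sqrt
        ‖∑ α ∈ Lam n m, multiWeight q α • (wordEval X.1 α * star (wordEval X.1 α))‖) →
      IsPolynomialOfDegreeLE (∑ i, m i) φ F) ∧
    ((∃ M : ℝ, ∀ X : CommTuple H n, ‖F X‖ ≤ M) → IsConstant φ F) := by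
  refine ⟨fun m C _ hC => ?_, fun ⟨M, hM⟩ => ?_⟩
  · refine isPolynomialOfDegreeLE_of_growth hk hn hH (hasSum_of_isEntire hq hF) fun X =>
      ⟨C * Real.sqrt
        ‖∑ α ∈ Lam n m, multiWeight q α • (wordEval X.1 α * star (wordEval X.1 α))‖,
        fun z => (hC _).trans_eq ?_⟩
    -- A word and its adjoint together contribute `‖z‖ ^ (2 * ∑ i, m i)` in norm, and the square
    -- root halves the exponent.
    have h : ∑ α ∈ Lam n m, multiWeight q α •
          (wordEval (z • X.1) α * star (wordEval (z • X.1) α)) =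
        (z ^ (∑ i, m i) * star (z ^ (∑ i, m i))) •
          ∑ α ∈ Lam n m, multiWeight q α • (wordEval X.1 α * star (wordEval X.1 α)) := by
      rw [Finset.smul_sum]
      refine Finset.sum_congr rfl fun α hα => ?_
      rw [wordEval_smul, sum_length_of_mem_Lam hα, star_smul, smul_mul_smul_comm, smul_comm]
    rw [h, norm_smul, norm_mul, norm_star, Real.sqrt_mul (by positivity),
      Real.sqrt_mul_self (norm_nonneg _), norm_pow]
    ring
  · refine isConstant_of_isPolynomialOfDegreeLE_zero <|
      isPolynomialOfDegreeLE_of_growth hk hn hH (hasSum_of_isEntire hq hF)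
        fun X => ⟨M, fun z => ?_⟩
    simpa using hM ⟨z • X.1, smul_mem_CommTuple z X.2⟩
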